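/- Let $X$ be a sequentially complete Hausdorff locally convex space over $\mathbb{K}\in\{\mathbb{R},\mathbb{C}\}$. An $lC_0$-semigroup on $X$ is a family $(T(l))_{l\ge 0}$ of continuous linear operators on $X$ with $T(0)=I$ and $T(l+m)=T(l)T(m)$ for all $l,m\ge 0$, such that $l\mapsto T(l)f$ is continuous on $[0,\infty)$ for every $f\in X$ and such that for every $r\ge 0$ the family $\{T(d/n)^m : n,m\in\mathbb{N},\ d\ge 0,\ md/n\le r\}$ is equicontinuous. Its generator is the linear operator $Zf=\lim_{h\to 0+}h^{-1}(T(h)f-f)$, defined for those $f$ for which the limit exists; one writes $T(l)=\exp(lZ)$. A set $D\subset\mathcal{D}(Z)$ is a core of $Z$ if the closure of $\{(x,Zx): x\in D\}$ in $X\times X$ is the graph of $Z$. **Theorem.** For every $s\ge 0$ let $Z_s$ be the generator of an $lC_0$-semigroup $(\exp(lZ_s))_{l\ge 0}$ on $X$, and assume that for every $l_0\ge 0$ the set $\{\exp(lZ_s) : l\in[0,l_0],\ s\ge 0\}$ is equicontinuous. Let $\mathscr{D}$ be the set of all $f\in\mathcal{D}(Z_0)$ for which there is a family $(f_s)_{s>0}$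 with $f_s\in\mathcal{D}(Z_s)$, $\lim_{s\to 0+}f_s=f$ and $\lim_{s\to 0+}Z_sf_s=Z_0f$. Then the following two conditions are equivalent: (i) for every $f\in X$ and every $t_0>0$, $\exp(lZ_s)f\to\exp(lZ_0)f$ as $s\to 0+$, uniformly with respect to $l\in[0,t_0]$; (ii) $\mathscr{D}$ is a core of $Z_0$. -/

import Mathlib

open Filter Topology Set
open scoped NNReal

namespace LCSemigroup

variable {𝕜 E : Type*} [RCLike 𝕜] [AddCommGroup E] [Module 𝕜 E]

/-- Every Cauchy sequence converges. -/
def IsSequentiallyComplete (E : Type*) [UniformSpace E] : Prop :=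
  ∀ u : ℕ → E, CauchySeq u → ∃ x : E, Tendsto u atTop (𝓝 x)

/-- A set of continuous linear operators on `E` is equicontinuous. For linear operators on a
locally convex space this is the usual domination of `sup_{G ∈ A} ‖G x‖_α` by a finite positive
combination of the generating seminorms of `x`. -/
def IsEquicontinuous [UniformSpace E] (A : Set (E →L[𝕜] E)) : Prop :=
  ((fun G : E →L[𝕜] E => (G : E → E)) '' A).Equicontinuous

/-- The family `{F(d/n)^m | m d / n ≤ s, n, m ∈ ℕ, d ≥ 0}`, with `n, m` positive. -/
def powerFamily [TopologicalSpace E] (F : ℝ≥0 → E →L[𝕜] E) (s : ℝ≥0) : Set (E →L[𝕜] E) :=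
  {G | ∃ (n m : ℕ) (d : ℝ≥0), 0 < n ∧ 0 < m ∧ m * d / n ≤ s ∧ G = F (d / n) ^ m}

/-- An `lC₀`-semigroup on `E`: a strongly continuous one-parameter semigroup of continuous
linear operators for which each of the families `powerFamily T s` is equicontinuous. -/
structure IsLC0Semigroup [UniformSpace E] (T : ℝ≥0 → E →L[𝕜] E) : Prop where
  map_zero : T 0 = ContinuousLinearMap.id 𝕜 E
  map_add : ∀ l m : ℝ≥0, T (l + m) = (T l).comp (T m)
  continuous : ∀ f : E, Continuous fun l => T l f
  equicontinuous : ∀ s : ℝ≥0, IsEquicontinuous (powerFamily T s)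

/-- `Z` is the generator of `T`, i.e. the strong derivative of `T` at `0`: its domain consists
of all `x` such that `lim_{h → 0+} h⁻¹ (T(h) x - T(0) x)` exists, and `Z x` is that limit. -/
def IsGenerator [TopologicalSpace E] (Z : E →ₗ.[𝕜] E) (T : ℝ≥0 → E →L[𝕜] E) : Prop :=
  ∀ x y : E, (x, y) ∈ Z.graph ↔
    Tendsto (fun h : ℝ≥0 => (((h : ℝ) : 𝕜))⁻¹ • (T h x - T 0 x)) (𝓝[>] 0) (𝓝 y)

/-- `D` is a core of `Z`: `D` is contained in the domain of `Z`, and the closure in `E × E` of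
the graph of the restriction of `Z` to `D` is the graph of `Z`. -/
def IsCore [TopologicalSpace E] (Z : E →ₗ.[𝕜] E) (D : Set E) : Prop :=
  D ⊆ (Z.domain : Set E) ∧
    closure {q : E × E | q ∈ Z.graph ∧ q.1 ∈ D} = (Z.graph : Set (E × E))

/-- The set of all `f ∈ D(Z₀)` for which there are `f_s ∈ D(Z_s)`, `s > 0`, such that
`f_s → f` and `Z_s f_s → Z₀ f` as `s → 0+`. -/
def approxDomain [TopologicalSpace E] (Z : ℝ≥0 → E →ₗ.[𝕜] E) : Set E :=
  {f | ∃ (hf : f ∈ (Z 0).domain) (u : (s : ℝ≥0) → (Z s).domain),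
    Tendsto (fun s => (u s : E)) (𝓝[>] 0) (𝓝 f) ∧
    Tendsto (fun s => Z s (u s)) (𝓝[>] 0) (𝓝 (Z 0 ⟨f, hf⟩))}

end LCSemigroup

/-!
The implication from convergence to the core property rests on means of orbits. For `g` in `E`
and `0 < a < 1` the mean `a⁻¹ ∫₀ᵃ T 0 l g dl` lies in the domain of `Z 0`, and `Z 0` maps it to
`a⁻¹ (T 0 a g - g)`. The same means formed with `T s` lie in the domain of `Z s`; if the
semigroups converge, then they and their images under `Z s` converge to the means for `T 0` and
their images under `Z 0`. So the approximable domain contains all these means, and for `g` in the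
domain of `Z 0` they tend to `g` in the graph topology as `a → 0+`. Since `Z 0` is closed, this is
the core property (`isCore_approxDomain`). No resolvent is used: for a locally equicontinuous
semigroup it need not exist.

For the converse, the core property says that each element of the graph of `Z 0` is close to the
graph of `Z s` for all small `s` (`IsCore.eventually_exists_mem_graph`). Let `x` be in the domain
of `Z 0`. On a short interval `[0, δ]` the orbit `T 0 l x` is close to a chord, whose end points can
be replaced by elements of the domain of `Z s`. Duhamel's estimate
(`IsGenerator.seminorm_orbit_sub_affine_le`) then bounds `T s l x - T 0 l x` by a constant times
`ε δ`, where `ε` is the oscillation of `T 0 l (Z 0 x)` on `[0, δ]`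
(`eventually_seminorm_sub_le_of_step`). Only finitely many steps are needed to cover `[0, t₀]`, so
one neighbourhood of `s = 0` serves for all of them, and by equicontinuity the local errors add up
to `O(ε)` (`seminorm_sub_le_of_steps`). Density of the domain of `Z 0` and equicontinuity extend the
convergence to all of `E` (`IsCore.tendstoUniformlyOn`).

The analysis of `E`-valued curves is reduced to a mean value inequality for seminorms
(`seminorm_sub_le_of_right_slope`) and to the existence of antiderivatives
(`exists_antiderivative`), which are limits of antiderivatives of Bernstein approximations; the
limit needs sequential completeness only.
-/

/-! ### Seminorms, right derivatives and the mean value inequality -/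

namespace LCSemigroup

section Seminorms

variable {𝕜 E : Type*} [RCLike 𝕜] [AddCommGroup E] [Module 𝕜 E]

theorem tendsto_nhds_iff_seminorm [TopologicalSpace E] [PolynormableSpace 𝕜 E] {ι : Type*}
    {l : Filter ι} {u : ι → E} {x : E} :
    Tendsto u l (𝓝 x) ↔
      ∀ p : Seminorm 𝕜 E, Continuous p → ∀ ε > 0, ∀ᶠ i in l, p (u i - x) < ε := by
  rw [(PolynormableSpace.withSeminorms 𝕜 E).tendsto_nhds u x]
  exact ⟨fun H p hp => H ⟨p, hp⟩, fun H p => H p.1 p.2⟩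

theorem tendstoUniformlyOn_iff_seminorm [UniformSpace E] [IsUniformAddGroup E]
    [PolynormableSpace 𝕜 E] {ι α : Type*} {l : Filter ι} {u : ι → α → E} {v : α → E}
    {S : Set α} :
    TendstoUniformlyOn u v l S ↔
      ∀ p : Seminorm 𝕜 E, Continuous p → ∀ ε > 0, ∀ᶠ i in l, ∀ a ∈ S,
        p (u i a - v a) < ε := by
  rw [tendstoUniformlyOn_iff_tendsto, uniformity_eq_comap_nhds_zero, tendsto_comap_iff,
    tendsto_nhds_iff_seminorm (𝕜 := 𝕜)]
  simp only [Function.comp_apply, sub_zero, eventually_prod_principal_iff]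

theorem cauchySeq_of_seminorm [UniformSpace E] [IsUniformAddGroup E] [PolynormableSpace 𝕜 E]
    {u : ℕ → E}
    (H : ∀ p : Seminorm 𝕜 E, Continuous p → ∀ ε > 0, ∃ N, ∀ m ≥ N, ∀ n ≥ N,
      p (u m - u n) < ε) : CauchySeq u := by
  rw [CauchySeq, cauchy_map_iff, uniformity_eq_comap_nhds_zero, tendsto_comap_iff,
    tendsto_nhds_iff_seminorm (𝕜 := 𝕜)]
  refine ⟨inferInstance, fun p hp ε hε => ?_⟩
  obtain ⟨N, hN⟩ := H p hp ε hε
  rw [prod_atTop_atTop_eq]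
  filter_upwards [eventually_ge_atTop (N, N)] with i hi
  simpa using hN _ hi.2 _ hi.1

theorem eq_of_seminorm_sub_le_zero [TopologicalSpace E] [PolynormableSpace 𝕜 E] [T2Space E]
    {x y : E} (H : ∀ p : Seminorm 𝕜 E, Continuous p → p (x - y) ≤ 0) : x = y := by
  have : Tendsto (fun _ : ℕ => x) atTop (𝓝 y) :=
    (tendsto_nhds_iff_seminorm (𝕜 := 𝕜)).2 fun p hp ε hε =>
      Eventually.of_forall fun _ => (H p hp).trans_lt hε
  exact tendsto_nhds_unique tendsto_const_nhds this

theorem IsEquicontinuous.exists_seminorm [UniformSpace E] [IsUniformAddGroup E]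
    [ContinuousSMul 𝕜 E] [PolynormableSpace 𝕜 E] {A : Set (E →L[𝕜] E)}
    (hA : IsEquicontinuous A) {p : Seminorm 𝕜 E} (hp : Continuous p) :
    ∃ q : Seminorm 𝕜 E, Continuous q ∧ ∀ G ∈ A, ∀ v, p (G v) ≤ q v := by
  have h1 : Equicontinuous ((↑) ∘ fun G : A => ((G : E →L[𝕜] E) : E →ₗ[𝕜] E)) :=
    Equicontinuous.comp hA (fun G : A => ⟨_, mem_image_of_mem _ G.2⟩)
  have h2 : Equicontinuous ((↑) ∘ fun G : A => ((G : E →L[𝕜] E) : E →ₗ[𝕜] E)) ↔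
      ∀ p : {p : Seminorm 𝕜 E // Continuous p}, ∃ q : Seminorm 𝕜 E, Continuous q ∧
        ∀ G : A, p.1.comp ((G : E →L[𝕜] E) : E →ₗ[𝕜] E) ≤ q :=
    ((PolynormableSpace.withSeminorms 𝕜 E).equicontinuous_TFAE
      (fun G : A => ((G : E →L[𝕜] E) : E →ₗ[𝕜] E))).out 1 3
  obtain ⟨q, hq, h⟩ := h2.1 h1 ⟨p, hp⟩
  exact ⟨q, hq, fun G hG v => h ⟨G, hG⟩ v⟩

theorem norm_coe_nnreal (h : ℝ≥0) : ‖((h : ℝ) : 𝕜)‖ = h := by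
  simp

/-- The mean value inequality for a seminorm: only an upper bound for the right difference
quotients is needed, not differentiability. -/
theorem seminorm_sub_le_of_right_slope [TopologicalSpace E] [IsTopologicalAddGroup E]
    {p : Seminorm 𝕜 E} (hp : Continuous p) {φ : ℝ≥0 → E} {a b : ℝ≥0} {C : ℝ}
    (hφ : ContinuousOn φ (Icc a b))
    (H : ∀ x ∈ Ico a b, ∀ C' > C, ∀ᶠ h : ℝ≥0 in 𝓝[>] 0, p (φ (x + h) - φ x) ≤ C' * h)
    {x : ℝ≥0} (hx : x ∈ Icc a b) : p (φ x - φ a) ≤ C * ((x : ℝ) - a) := by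
  have key : ∀ C' > C, ∀ x ∈ Icc a b, p (φ x - φ a) ≤ C' * ((x : ℝ) - a) := by
    intro C' hC'
    have hcl : IsClosed ({x : ℝ≥0 | p (φ x - φ a) ≤ C' * ((x : ℝ) - a)} ∩ Icc a b) := by
      have h1 : ContinuousOn (fun x => (p (φ x - φ a), C' * ((x : ℝ) - a))) (Icc a b) :=
        (hp.comp_continuousOn (hφ.sub continuousOn_const)).prodMk
          (by fun_prop : Continuous fun x : ℝ≥0 => C' * ((x : ℝ) - a)).continuousOn
      have := h1.preimage_isClosed_of_isClosed isClosed_Icc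
        OrderClosedTopology.isClosed_le'
      rwa [inter_comm] at this
    refine hcl.Icc_subset_of_forall_exists_gt (by simp) ?_
    rintro x ⟨hx, hxab⟩ y hy
    have h1 := H x hxab C' hC'
    have h2 : ∀ᶠ h : ℝ≥0 in 𝓝[>] 0, x + h ∈ Ioc x y := by
      have hpos : 0 < y - x := tsub_pos_of_lt hy
      filter_upwards [Ioc_mem_nhdsGT hpos] with h hh
      exact ⟨lt_add_of_pos_right _ hh.1,
        (add_le_add_right hh.2 x).trans_eq (add_tsub_cancel_of_le (le_of_lt hy))⟩
    obtain ⟨h, hh1, hh2⟩ := (h1.and h2).exists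
    refine ⟨x + h, ?_, hh2⟩
    have hx' : p (φ x - φ a) ≤ C' * ((x : ℝ) - a) := hx
    calc p (φ (x + h) - φ a) = p ((φ (x + h) - φ x) + (φ x - φ a)) := by congr 1; abel
      _ ≤ C' * h + C' * ((x : ℝ) - a) := (map_add_le_add p _ _).trans (add_le_add hh1 hx')
      _ = C' * (((x + h : ℝ≥0) : ℝ) - a) := by push_cast; ring
  have hxa : 0 ≤ (x : ℝ) - a := sub_nonneg.2 (by exact_mod_cast hx.1)
  refine ge_of_tendsto (f := fun C' : ℝ => C' * ((x : ℝ) - a)) (x := 𝓝[>] C) ?_ ?_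
  · exact ((continuous_id.mul continuous_const).tendsto C).mono_left nhdsWithin_le_nhds
  · filter_upwards [self_mem_nhdsWithin] with C' hC' using key C' hC' x hx

end Seminorms

section RightDerivative

variable {E : Type*} (𝕜 : Type*) [RCLike 𝕜] [AddCommGroup E] [Module 𝕜 E]

/-- `φ : [0, ∞) → E` has the right derivative `y` at `x`. The increment is a nonnegative real
and the difference quotient is written with scalars in `𝕜`, as in `IsGenerator`. -/
def HasRightDerivAt [TopologicalSpace E] (φ : ℝ≥0 → E) (y : E) (x : ℝ≥0) : Prop :=
  Tendsto (fun h : ℝ≥0 => (((h : ℝ) : 𝕜))⁻¹ • (φ (x + h) - φ x)) (𝓝[>] 0) (𝓝 y)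

variable {𝕜}

namespace HasRightDerivAt

variable [TopologicalSpace E] {φ ψ : ℝ≥0 → E} {y z : E} {x : ℝ≥0}

theorem sub [IsTopologicalAddGroup E] (h₁ : HasRightDerivAt 𝕜 φ y x)
    (h₂ : HasRightDerivAt 𝕜 ψ z x) : HasRightDerivAt 𝕜 (fun t => φ t - ψ t) (y - z) x := by
  refine (Tendsto.sub h₁ h₂).congr fun h => ?_
  rw [← smul_sub]
  exact congrArg _ (sub_sub_sub_comm _ _ _ _)

theorem sum [IsTopologicalAddGroup E] {ι : Type*} (s : Finset ι) {φ : ι → ℝ≥0 → E} {y : ι → E}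
    (H : ∀ i ∈ s, HasRightDerivAt 𝕜 (φ i) (y i) x) :
    HasRightDerivAt 𝕜 (fun t => ∑ i ∈ s, φ i t) (∑ i ∈ s, y i) x := by
  refine (tendsto_finsetSum s H).congr fun h => ?_
  rw [← Finset.sum_sub_distrib, Finset.smul_sum]

theorem clm_comp (G : E →L[𝕜] E) (h : HasRightDerivAt 𝕜 φ y x) :
    HasRightDerivAt 𝕜 (fun t => G (φ t)) (G y) x := by
  refine ((G.continuous.tendsto y).comp h).congr fun t => ?_
  simp

theorem comp_add_const {c : ℝ≥0} (h : HasRightDerivAt 𝕜 φ y (x + c)) :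
    HasRightDerivAt 𝕜 (fun t => φ (t + c)) y x := by
  refine Tendsto.congr (fun t => ?_) h
  simp only [add_right_comm]

theorem of_hasDerivAt [ContinuousSMul 𝕜 E] {r : ℝ → ℝ} {r' : ℝ} (h : HasDerivAt r r' x) (v : E) :
    HasRightDerivAt 𝕜 (fun t => ((r t : ℝ) : 𝕜) • v) ((r' : 𝕜) • v) x := by
  have h1 : Tendsto (fun h : ℝ≥0 => (h : ℝ)) (𝓝[>] 0) (𝓝[>] 0) := by
    refine tendsto_nhdsWithin_iff.2 ⟨?_, ?_⟩
    · exact (NNReal.continuous_coe.tendsto' 0 0 (by simp)).mono_left nhdsWithin_le_nhds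
    · filter_upwards [self_mem_nhdsWithin] with h hh using NNReal.coe_pos.2 hh
  have h2 := ((RCLike.continuous_ofReal (K := 𝕜)).tendsto r').comp
    (h.tendsto_slope_zero_right.comp h1)
  refine (h2.smul_const v).congr fun t => ?_
  simp [← sub_smul, smul_smul]

theorem eventually_le {p : Seminorm 𝕜 E} (hp : Continuous p) (h : HasRightDerivAt 𝕜 φ y x)
    {C : ℝ} (hC : p y < C) : ∀ᶠ t : ℝ≥0 in 𝓝[>] 0, p (φ (x + t) - φ x) ≤ C * t := by
  filter_upwards [((hp.tendsto y).comp h).eventually_lt_const hC, self_mem_nhdsWithin]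
    with t ht ht0
  have h0 : (0 : ℝ) < t := NNReal.coe_pos.2 ht0
  simp only [Function.comp_apply, map_smul_eq_mul, norm_inv, norm_coe_nnreal] at ht
  rw [inv_mul_lt_iff₀ h0] at ht
  linarith

end HasRightDerivAt

/-- The mean value inequality for a function with bounded right derivative. -/
theorem seminorm_sub_le_of_hasRightDerivAt [TopologicalSpace E] [IsTopologicalAddGroup E]
    {p : Seminorm 𝕜 E} (hp : Continuous p) {φ φ' : ℝ≥0 → E} {a b : ℝ≥0} {C : ℝ}
    (hφ : ContinuousOn φ (Icc a b)) (H : ∀ x ∈ Ico a b, HasRightDerivAt 𝕜 φ (φ' x) x)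
    (hC : ∀ x ∈ Ico a b, p (φ' x) ≤ C) {x : ℝ≥0} (hx : x ∈ Icc a b) :
    p (φ x - φ a) ≤ C * ((x : ℝ) - a) :=
  seminorm_sub_le_of_right_slope hp hφ
    (fun t ht _ hC' => (H t ht).eventually_le hp ((hC t ht).trans_lt hC')) hx

end RightDerivative

/-! ### Antiderivatives of curves in a sequentially complete space -/

section Antiderivative

variable {E : Type*} (𝕜 : Type*) [RCLike 𝕜] [AddCommGroup E] [Module 𝕜 E]

/-- On `[0, 1]` a continuous curve is a uniform limit of right derivatives of continuous curves:
integrate its Bernstein approximations. -/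
theorem exists_approx_antiderivative [UniformSpace E] [IsUniformAddGroup E]
    [ContinuousSMul 𝕜 E] [PolynormableSpace 𝕜 E] {f : ℝ≥0 → E} (hf : Continuous f) :
    ∃ F F' : ℕ → ℝ≥0 → E, (∀ n, F n 0 = 0) ∧ (∀ n, Continuous (F n)) ∧
      (∀ n, ∀ x ∈ Ico (0 : ℝ≥0) 1, HasRightDerivAt 𝕜 (F n) (F' n x) x) ∧
      ∀ p : Seminorm 𝕜 E, Continuous p → ∀ ε > 0, ∀ᶠ n in atTop,
        ∀ x ∈ Ico (0 : ℝ≥0) 1, p (F' n x - f x) < ε := by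
  -- Mathlib states Bernstein approximation for real vector spaces.
  let : Module ℝ E := Module.compHom E (algebraMap ℝ 𝕜)
  have hsm : ∀ (r : ℝ) (v : E), r • v = (r : 𝕜) • v := fun r v => rfl
  have : IsScalarTower ℝ 𝕜 E := ⟨fun r c v => by
    rw [hsm, smul_smul, RCLike.real_smul_eq_coe_mul]⟩
  have : ContinuousSMul ℝ E := ⟨by
    have : Continuous fun q : ℝ × E => ((q.1 : ℝ) : 𝕜) • q.2 :=
      (RCLike.continuous_ofReal.comp continuous_fst).smul continuous_snd
    exact this⟩
  have : LocallyConvexSpace ℝ E :=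
    (PolynormableSpace.withSeminorms 𝕜 E).toLocallyConvexSpace
  let g : C(unitInterval, E) := ⟨fun t => f (Real.toNNReal t), by fun_prop⟩
  have hg := ContinuousMap.tendsto_iff_tendstoUniformly.1 (bernsteinApproximation_uniform g)
  let b : ℕ → ℕ → ℝ → ℝ := fun n k t => (bernsteinPolynomial ℝ n k).eval t
  have hb : ∀ n k, Continuous (b n k) := fun n k => (bernsteinPolynomial ℝ n k).continuous
  have hB : ∀ n k x, HasDerivAt (fun x => ∫ t in (0 : ℝ)..x, b n k t) (b n k x) x :=
    fun n k x => ((hb n k).integral_hasStrictDerivAt 0 x).hasDerivAt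
  let F : ℕ → ℝ≥0 → E := fun n x => ∑ k : Fin (n + 1),
    ((∫ t in (0 : ℝ)..x, b n k t : ℝ) : 𝕜) • g (bernstein.z k)
  let F' : ℕ → ℝ≥0 → E := fun n x => ∑ k : Fin (n + 1),
    ((b n k x : ℝ) : 𝕜) • g (bernstein.z k)
  refine ⟨F, F', fun n => by simp [F], fun n => ?_, fun n x _ => ?_, fun p hp ε hε => ?_⟩
  · refine continuous_finsetSum _ fun k _ => Continuous.smul ?_ continuous_const
    have hc : Continuous fun x => ∫ t in (0 : ℝ)..x, b n k t :=
      continuous_iff_continuousAt.2 fun x => (hB n k x).continuousAt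
    exact RCLike.continuous_ofReal.comp (hc.comp NNReal.continuous_coe)
  · exact HasRightDerivAt.sum _ fun k _ => HasRightDerivAt.of_hasDerivAt (hB n k x) _
  · have h1 := (tendstoUniformlyOn_iff_seminorm (𝕜 := 𝕜)).1
      (hg.tendstoUniformlyOn (s := univ)) p hp ε hε
    filter_upwards [h1] with n hn x hx
    have h2 := hn ⟨x, x.2, by exact_mod_cast hx.2.le⟩ (mem_univ _)
    have h3 : g ⟨x, x.2, by exact_mod_cast hx.2.le⟩ = f x := congrArg f Real.toNNReal_coe
    rw [bernsteinApproximation.apply, h3] at h2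
    exact h2

variable {𝕜}

/-- In a sequentially complete locally convex space every continuous curve has an antiderivative
on `[0, 1]`. This replaces the vector-valued Riemann integral. -/
theorem exists_antiderivative [UniformSpace E] [IsUniformAddGroup E] [ContinuousSMul 𝕜 E]
    [PolynormableSpace 𝕜 E] [T2Space E] (hE : IsSequentiallyComplete E) {f : ℝ≥0 → E}
    (hf : Continuous f) :
    ∃ F : ℝ≥0 → E, F 0 = 0 ∧ ContinuousOn F (Icc 0 1) ∧
      ∀ x ∈ Ico (0 : ℝ≥0) 1, HasRightDerivAt 𝕜 F (f x) x := by
  obtain ⟨F, F', hF0, hFc, hF, hF'⟩ := exists_approx_antiderivative 𝕜 hf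
  -- The increments of `F m - F n` are small relative to the length of the interval.
  have key : ∀ p : Seminorm 𝕜 E, Continuous p → ∀ ε > 0, ∃ N, ∀ m ≥ N, ∀ n ≥ N,
      ∀ x y : ℝ≥0, x ≤ y → y ≤ 1 →
        p ((F m y - F n y) - (F m x - F n x)) ≤ ε * ((y : ℝ) - x) := by
    intro p hp ε hε
    obtain ⟨N, hN⟩ := eventually_atTop.1 (hF' p hp (ε / 2) (half_pos hε))
    refine ⟨N, fun m hm n hn x y hxy hy => ?_⟩
    refine seminorm_sub_le_of_hasRightDerivAt (φ := fun t => F m t - F n t)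
      (φ' := fun t => F' m t - F' n t) (b := 1) hp ((hFc m).sub (hFc n)).continuousOn
      (fun t ht => (hF m t ⟨zero_le, ht.2⟩).sub (hF n t ⟨zero_le, ht.2⟩)) (fun t ht => ?_)
      ⟨hxy, hy⟩
    calc p (F' m t - F' n t) = p ((F' m t - f t) - (F' n t - f t)) := by
          rw [sub_sub_sub_cancel_right]
      _ ≤ p (F' m t - f t) + p (F' n t - f t) := map_sub_le_add p _ _
      _ ≤ ε := by linarith [hN m hm t ⟨zero_le, ht.2⟩, hN n hn t ⟨zero_le, ht.2⟩]
  have hcauchy : ∀ x : ℝ≥0, x ≤ 1 → CauchySeq fun n => F n x := by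
    refine fun x hx => cauchySeq_of_seminorm (𝕜 := 𝕜) fun p hp ε hε => ?_
    obtain ⟨N, hN⟩ := key p hp (ε / 2) (half_pos hε)
    refine ⟨N, fun m hm n hn => ?_⟩
    have h := hN m hm n hn 0 x zero_le hx
    simp only [hF0, sub_zero, NNReal.coe_zero] at h
    have hx1 : (x : ℝ) ≤ 1 := by exact_mod_cast hx
    nlinarith
  have hlim : ∀ x : ℝ≥0, ∃ y, x ≤ 1 → Tendsto (fun n => F n x) atTop (𝓝 y) := by
    intro x
    by_cases hx : x ≤ 1
    · obtain ⟨y, hy⟩ := hE _ (hcauchy x hx)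
      exact ⟨y, fun _ => hy⟩
    · exact ⟨0, fun h => absurd h hx⟩
  choose G hG using hlim
  have hG0 : G 0 = 0 := tendsto_nhds_unique (hG 0 zero_le_one) (by simp [hF0])
  have keyG : ∀ p : Seminorm 𝕜 E, Continuous p → ∀ ε > 0, ∃ N, ∀ n ≥ N,
      ∀ x y : ℝ≥0, x ≤ y → y ≤ 1 →
        p ((F n y - G y) - (F n x - G x)) ≤ ε * ((y : ℝ) - x) := by
    intro p hp ε hε
    obtain ⟨N, hN⟩ := key p hp ε hε
    refine ⟨N, fun n hn x y hxy hy => ?_⟩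
    refine le_of_tendsto ((hp.tendsto _).comp ((tendsto_const_nhds.sub (hG y hy)).sub
      (tendsto_const_nhds.sub (hG x (hxy.trans hy))))) ?_
    filter_upwards [eventually_ge_atTop N] with m hm using hN n hn m hm x y hxy hy
  refine ⟨G, hG0, ?_, fun x hx => ?_⟩
  · have hu : TendstoUniformlyOn F G atTop (Icc 0 1) := by
      refine (tendstoUniformlyOn_iff_seminorm (𝕜 := 𝕜)).2 fun p hp ε hε => ?_
      obtain ⟨N, hN⟩ := keyG p hp (ε / 2) (half_pos hε)
      filter_upwards [eventually_ge_atTop N] with n hn x hx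
      have h := hN n hn 0 x zero_le hx.2
      simp only [hF0, hG0, sub_zero, NNReal.coe_zero] at h
      have hx1 : (x : ℝ) ≤ 1 := by exact_mod_cast hx.2
      nlinarith
    exact hu.continuousOn (Frequently.of_forall fun n => (hFc n).continuousOn)
  · refine (tendsto_nhds_iff_seminorm (𝕜 := 𝕜)).2 fun p hp ε hε => ?_
    obtain ⟨N, hN⟩ := keyG p hp (ε / 3) (by positivity)
    obtain ⟨n, hn, hn'⟩ := ((eventually_ge_atTop N).and (hF' p hp (ε / 3) (by positivity))).exists
    have h1 := (tendsto_nhds_iff_seminorm (𝕜 := 𝕜)).1 (hF n x hx) p hp (ε / 3) (by positivity)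
    have hpos : 0 < 1 - x := tsub_pos_of_lt hx.2
    filter_upwards [h1, Ioc_mem_nhdsGT hpos] with h hh hh'
    have hle : x + h ≤ 1 := (add_le_add_right hh'.2 x).trans_eq (add_tsub_cancel_of_le hx.2.le)
    have h2 := hN n hn x (x + h) le_self_add hle
    have h0 : (0 : ℝ) < h := NNReal.coe_pos.2 hh'.1
    have h3 : p ((((h : ℝ) : 𝕜))⁻¹ • ((F n (x + h) - G (x + h)) - (F n x - G x))) ≤ ε / 3 := by
      rw [map_smul_eq_mul, norm_inv, norm_coe_nnreal, inv_mul_le_iff₀ h0]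
      refine h2.trans_eq ?_
      push_cast; ring
    have h4 := hn' x hx
    calc p ((((h : ℝ) : 𝕜))⁻¹ • (G (x + h) - G x) - f x)
        = p (((((h : ℝ) : 𝕜))⁻¹ • (F n (x + h) - F n x) - F' n x) + (F' n x - f x)
            - (((h : ℝ) : 𝕜))⁻¹ • ((F n (x + h) - G (x + h)) - (F n x - G x))) := by
          congr 1; module
      _ ≤ p ((((h : ℝ) : 𝕜))⁻¹ • (F n (x + h) - F n x) - F' n x) + p (F' n x - f x)
            + p ((((h : ℝ) : 𝕜))⁻¹ • ((F n (x + h) - G (x + h)) - (F n x - G x))) :=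
          (map_sub_le_add p _ _).trans (add_le_add_left (map_add_le_add p _ _) _)
      _ < ε := by linarith

end Antiderivative

/-! ### Semigroups and their generators -/

section Semigroup

variable {𝕜 E : Type*} [RCLike 𝕜] [AddCommGroup E] [Module 𝕜 E] [UniformSpace E]
  {T : ℝ≥0 → E →L[𝕜] E} {Z : E →ₗ.[𝕜] E}

theorem IsLC0Semigroup.map_zero_apply (hT : IsLC0Semigroup T) (v : E) : T 0 v = v := by
  rw [hT.map_zero]; rfl

theorem IsLC0Semigroup.map_add_apply (hT : IsLC0Semigroup T) (l m : ℝ≥0) (v : E) :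
    T (l + m) v = T l (T m v) := by
  rw [hT.map_add]; rfl

theorem IsLC0Semigroup.exists_seminorm [IsUniformAddGroup E] [ContinuousSMul 𝕜 E]
    [PolynormableSpace 𝕜 E] (hT : IsLC0Semigroup T) {p : Seminorm 𝕜 E} (hp : Continuous p)
    (l₀ : ℝ≥0) : ∃ q : Seminorm 𝕜 E, Continuous q ∧ ∀ l ≤ l₀, ∀ v, p (T l v) ≤ q v := by
  obtain ⟨q, hq, h⟩ := (hT.equicontinuous l₀).exists_seminorm hp
  exact ⟨q, hq, fun l hl => h _ ⟨1, 1, l, one_pos, one_pos, by simpa using hl, by simp⟩⟩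

theorem IsGenerator.mem_graph_iff (hZ : IsGenerator Z T) {x y : E} :
    (x, y) ∈ Z.graph ↔ HasRightDerivAt 𝕜 (fun l => T l x) y 0 := by
  rw [hZ x y, HasRightDerivAt]
  simp only [zero_add]

theorem IsGenerator.apply_mem_graph (hT : IsLC0Semigroup T) (hZ : IsGenerator Z T) {x y : E}
    (h : (x, y) ∈ Z.graph) (l : ℝ≥0) : (T l x, T l y) ∈ Z.graph := by
  rw [hZ.mem_graph_iff] at h ⊢
  refine (h.clm_comp (T l)).congr fun t => ?_
  simp only [← hT.map_add_apply, add_comm]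

theorem IsGenerator.hasRightDerivAt (hT : IsLC0Semigroup T) (hZ : IsGenerator Z T) {x y : E}
    (h : (x, y) ∈ Z.graph) (l : ℝ≥0) : HasRightDerivAt 𝕜 (fun l => T l x) (T l y) l := by
  have h1 := (hZ.mem_graph_iff).1 (hZ.apply_mem_graph hT h l)
  refine h1.congr fun t => ?_
  simp only [← hT.map_add_apply, add_comm, add_zero]

variable [IsUniformAddGroup E]

/-- The integral of an orbit over `[0, a]` is in the domain of the generator. -/
theorem IsGenerator.antiderivative_mem_graph [PolynormableSpace 𝕜 E] [T2Space E]
    (hT : IsLC0Semigroup T) (hZ : IsGenerator Z T)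
    {g : E} {F : ℝ≥0 → E} (hF0 : F 0 = 0) (hFc : ContinuousOn F (Icc 0 1))
    (hF : ∀ x ∈ Ico (0 : ℝ≥0) 1, HasRightDerivAt 𝕜 F (T x g) x) {a : ℝ≥0} (ha : a < 1) :
    (F a, T a g - g) ∈ Z.graph := by
  -- Both sides vanish at `a = 0` and have the right derivative `T (a + h) g` in `a`.
  have key : ∀ h : ℝ≥0, a + h ≤ 1 → T h (F a) = F (a + h) - F h := by
    intro h hh
    refine eq_of_seminorm_sub_le_zero (𝕜 := 𝕜) fun p hp => ?_
    have hle : ∀ x ∈ Icc 0 a, x + h ∈ Icc (0 : ℝ≥0) 1 := fun x hx =>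
      ⟨zero_le, (add_le_add_left hx.2 h).trans hh⟩
    have hlt : ∀ x ∈ Ico 0 a, x + h ∈ Ico (0 : ℝ≥0) 1 := fun x hx =>
      ⟨zero_le, (add_lt_add_left hx.2 h).trans_le hh⟩
    have h1 := seminorm_sub_le_of_hasRightDerivAt (𝕜 := 𝕜) (b := a) (a := 0) (C := 0) hp
      (φ := fun x => T h (F x) - F (x + h)) (φ' := fun x => T h (T x g) - T (x + h) g)
      (((T h).continuous.comp_continuousOn (hFc.mono (Icc_subset_Icc_right ha.le))).sub
        (hFc.comp (by fun_prop) hle))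
      (fun x hx => ((hF x ⟨hx.1, hx.2.trans ha⟩).clm_comp (T h)).sub
        (HasRightDerivAt.comp_add_const (hF _ (hlt x hx))))
      (fun x hx => by rw [add_comm x h, hT.map_add_apply, sub_self, map_zero])
      (x := a) ⟨zero_le, le_rfl⟩
    simp only [hF0, map_zero, zero_add, zero_mul, zero_sub, sub_neg_eq_add] at h1
    convert h1 using 2
    abel
  rw [hZ.mem_graph_iff]
  have h0 := hF 0 ⟨le_rfl, one_pos⟩
  rw [hT.map_zero_apply] at h0
  have h1 := Tendsto.sub (hF a ⟨zero_le, ha⟩) h0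
  refine Tendsto.congr' ?_ h1
  have hpos : 0 < 1 - a := tsub_pos_of_lt ha
  filter_upwards [Ioc_mem_nhdsGT hpos] with h hh
  have hle : a + h ≤ 1 := (add_le_add_right hh.2 a).trans_eq (add_tsub_cancel_of_le ha.le)
  rw [zero_add, key h hle, hT.map_zero_apply, hF0, sub_zero, ← smul_sub, sub_right_comm]

variable [ContinuousSMul 𝕜 E]

/-- If `T` moves `y` by at most `ε` on `[0, δ)`, then the first-order Taylor remainder of
`l ↦ T l x` at `0` is at most `ε l` on `[0, δ]`, for `x` in the domain with `Z x = y`. -/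
theorem IsGenerator.seminorm_taylor_le (hT : IsLC0Semigroup T) (hZ : IsGenerator Z T)
    {p : Seminorm 𝕜 E} (hp : Continuous p) {x y : E} (h : (x, y) ∈ Z.graph) {δ : ℝ≥0} {ε : ℝ}
    (hε : ∀ l < δ, p (T l y - y) ≤ ε) {l : ℝ≥0} (hl : l ≤ δ) :
    p (T l x - x - ((l : ℝ) : 𝕜) • y) ≤ ε * l := by
  have h1 := seminorm_sub_le_of_hasRightDerivAt (𝕜 := 𝕜) (b := δ) (a := 0) (C := ε) hp
    (φ := fun t => T t x - (((t : ℝ)) : 𝕜) • y) (φ' := fun t => T t y - ((1 : ℝ) : 𝕜) • y)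
    ((hT.continuous x).sub ((RCLike.continuous_ofReal.comp NNReal.continuous_coe).smul
      continuous_const)).continuousOn
    (fun t _ => (hZ.hasRightDerivAt hT h t).sub
      (HasRightDerivAt.of_hasDerivAt (r := fun t => t) (hasDerivAt_id _) y))
    (fun t ht => by simpa using hε t ht.2) (x := l) ⟨zero_le, hl⟩
  simp only [NNReal.coe_zero, sub_zero, hT.map_zero_apply, RCLike.ofReal_zero, zero_smul] at h1
  rwa [sub_right_comm] at h1

variable [PolynormableSpace 𝕜 E]

theorem IsGenerator.isClosed_graph (hT : IsLC0Semigroup T) (hZ : IsGenerator Z T) :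
    IsClosed (Z.graph : Set (E × E)) := by
  refine isClosed_of_closure_subset fun ⟨x, y⟩ hxy => ?_
  refine (hZ.mem_graph_iff).2 ((tendsto_nhds_iff_seminorm (𝕜 := 𝕜)).2 fun p hp ε hε => ?_)
  obtain ⟨q, hq, hpq⟩ := hT.exists_seminorm hp 1
  have h1 : ∀ᶠ l in 𝓝 (0 : ℝ≥0), p (T l y - y) < ε / 3 := by
    have := ((hT.continuous y).tendsto' 0 y (hT.map_zero_apply y))
    exact (tendsto_nhds_iff_seminorm (𝕜 := 𝕜)).1 this p hp _ (by positivity)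
  obtain ⟨δ, hδ, hδy⟩ := (NNReal.nhds_zero_basis.eventually_iff).1 h1
  filter_upwards [Ioo_mem_nhdsGT (lt_min hδ one_pos)] with h hh
  have hh1 : h ≤ 1 := (hh.2.trans_le (min_le_right _ _)).le
  have h0 : (0 : ℝ) < h := NNReal.coe_pos.2 hh.1
  -- Approximate `(x, y)` by an element of the graph within a margin that depends on `h`.
  have hc : Tendsto (fun z : E × E => (q (z.1 - x), q (z.2 - y), p (z.1 - x), p (z.2 - y)))
      (𝓝 (x, y)) (𝓝 (0, 0, 0, 0)) := by
    refine Continuous.tendsto' (by fun_prop) _ _ (by simp)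
  have hsmall : Iio (ε / 12 * h) ×ˢ Iio (ε / 12) ×ˢ Iio (ε / 12 * h) ×ˢ Iio (ε / 12)
      ∈ 𝓝 ((0, 0, 0, 0) : ℝ × ℝ × ℝ × ℝ) := by
    refine prod_mem_nhds (Iio_mem_nhds (by positivity)) (prod_mem_nhds
      (Iio_mem_nhds (by positivity)) (prod_mem_nhds (Iio_mem_nhds (by positivity))
      (Iio_mem_nhds (by positivity))))
  obtain ⟨⟨x', y'⟩, ⟨ha, hb, hc, hd⟩, hgraph⟩ :=
    mem_closure_iff_nhds.1 hxy _ (hc hsmall)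
  simp only [mem_Iio] at ha hb hc hd
  have h2 : ∀ l < h, p (T l y' - y') ≤ ε / 2 := fun l hl => by
    calc p (T l y' - y') = p (T l (y' - y) + (T l y - y) - (y' - y)) := by
          rw [map_sub (T l)]; congr 1; abel
      _ ≤ p (T l (y' - y)) + p (T l y - y) + p (y' - y) :=
          (map_sub_le_add p _ _).trans (add_le_add_left (map_add_le_add p _ _) _)
      _ ≤ ε / 2 := by
          have := hpq l (hl.le.trans hh1) (y' - y)
          have := hδy (show l ∈ Iio δ from hl.trans (hh.2.trans_le (min_le_left _ _)))
          linarith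
  have h3 := hZ.seminorm_taylor_le hT hp hgraph h2 le_rfl
  have h4 : p (T h x - x - ((h : ℝ) : 𝕜) • y) < ε * h := by
    calc p (T h x - x - ((h : ℝ) : 𝕜) • y)
        = p ((T h x' - x' - ((h : ℝ) : 𝕜) • y') - T h (x' - x) + (x' - x)
          + ((h : ℝ) : 𝕜) • (y' - y)) := by
          rw [map_sub (T h), smul_sub]; congr 1; abel
      _ ≤ p (T h x' - x' - ((h : ℝ) : 𝕜) • y') + p (T h (x' - x)) + p (x' - x)
          + p (((h : ℝ) : 𝕜) • (y' - y)) :=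
          (map_add_le_add p _ _).trans (add_le_add_left ((map_add_le_add p _ _).trans
            (add_le_add_left (map_sub_le_add p _ _) _)) _)
      _ < ε * h := by
          rw [map_smul_eq_mul, norm_coe_nnreal]
          have := hpq h hh1 (x' - x)
          nlinarith
  have h5 : (((h : ℝ) : 𝕜))⁻¹ • (T (0 + h) x - T 0 x) - y
      = (((h : ℝ) : 𝕜))⁻¹ • (T h x - x - ((h : ℝ) : 𝕜) • y) := by
    have : ((h : ℝ) : 𝕜) ≠ 0 := by exact_mod_cast h0.ne'
    rw [zero_add, hT.map_zero_apply, smul_sub _ _ (((h : ℝ) : 𝕜) • y), inv_smul_smul₀ this]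
  rw [h5, map_smul_eq_mul, norm_inv, norm_coe_nnreal, inv_mul_lt_iff₀ h0]
  linarith

end Semigroup

/-! ### Short-time comparison of two semigroups -/

section Convergence

variable {𝕜 E : Type*} [RCLike 𝕜] [AddCommGroup E] [Module 𝕜 E] [UniformSpace E]

/-- Telescoping of the local errors along the multiples of the step size `δ`. -/
theorem seminorm_sub_le_of_steps {S T : ℝ≥0 → E →L[𝕜] E} (hS : IsLC0Semigroup S)
    (hT : IsLC0Semigroup T) {p p' : Seminorm 𝕜 E} {t δ : ℝ≥0} {ε : ℝ} {x : E} {N : ℕ}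
    (hp : ∀ l ≤ t, ∀ v, p (S l v) ≤ p' v)
    (hstep : ∀ n < N, p' (S δ (T (n * δ) x) - T δ (T (n * δ) x)) ≤ ε) :
    ∀ n ≤ N, ∀ r, n * δ + r ≤ t →
      p (S r (S (n * δ) x) - S r (T (n * δ) x)) ≤ n * ε := by
  intro n
  induction n with
  | zero => simp [hS.map_zero_apply, hT.map_zero_apply]
  | succ n ih =>
    intro hn r hr
    have hsucc : ((n + 1 : ℕ) : ℝ≥0) * δ = δ + n * δ := by push_cast; ring
    rw [hsucc] at hr ⊢
    have h1 := ih (by omega) (r + δ) ((le_of_eq (by ring)).trans hr)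
    have h2 := (hp r (le_trans le_add_self hr) (S δ (T (n * δ) x) - T δ (T (n * δ) x))).trans
      (hstep n (by omega))
    have h3 : S r (S (δ + n * δ) x) - S r (T (δ + n * δ) x)
        = (S (r + δ) (S (n * δ) x) - S (r + δ) (T (n * δ) x))
          + S r (S δ (T (n * δ) x) - T δ (T (n * δ) x)) := by
      rw [hS.map_add_apply δ, hT.map_add_apply δ, hS.map_add_apply r δ, hS.map_add_apply r δ,
        map_sub]
      abel
    rw [h3]
    refine (map_add_le_add p _ _).trans ?_
    push_cast
    linarith

variable [IsUniformAddGroup E] [ContinuousSMul 𝕜 E]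

/-- Duhamel's estimate for an affine curve `r ↦ w + r u` in the domain of the generator: it
follows the orbit of `w` up to the accumulated defect `u - Z (w + r u)`. -/
theorem IsGenerator.seminorm_orbit_sub_affine_le {T : ℝ≥0 → E →L[𝕜] E} {Z : E →ₗ.[𝕜] E}
    (hT : IsLC0Semigroup T) (hZ : IsGenerator Z T) {p q : Seminorm 𝕜 E} (hp : Continuous p)
    (hq : Continuous q) {δ : ℝ≥0} (hpq : ∀ l ≤ δ, ∀ v, p (T l v) ≤ q v) {w a u c : E}
    (hw : (w, a) ∈ Z.graph) (hu : (u, c) ∈ Z.graph) {C : ℝ}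
    (hC : ∀ r ≤ δ, q (u - (a + ((r : ℝ) : 𝕜) • c)) ≤ C) {ρ : ℝ≥0} (hρ : ρ ≤ δ) :
    p (T ρ w - (w + ((ρ : ℝ) : 𝕜) • u)) ≤ C * ρ := by
  -- The curve below joins `T ρ w` to `w + ρ u`.
  have h1 := seminorm_sub_le_of_right_slope (a := 0) (b := ρ) (C := C) hp
    (φ := fun r => T (ρ - r) w + ((r : ℝ) : 𝕜) • T (ρ - r) u) ?_ ?_
    (x := ρ) ⟨zero_le, le_rfl⟩
  · simp only [tsub_self, tsub_zero, NNReal.coe_zero, RCLike.ofReal_zero, zero_smul, add_zero,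
      hT.map_zero_apply] at h1
    rwa [map_sub_rev]
  · refine (((hT.continuous w).comp (continuous_const.sub continuous_id)).add
      ((RCLike.continuous_ofReal.comp NNReal.continuous_coe).smul
        ((hT.continuous u).comp (continuous_const.sub continuous_id)))).continuousOn
  · intro r hr C' hC'
    -- With `v = w + r u`, the increment of the curve is `T (ρ - r - h)` applied to
    -- `v + h u - T h v`, which is to first order `h (u - Z v)`.
    set v := w + ((r : ℝ) : 𝕜) • u with hv
    have hvg : (v, a + ((r : ℝ) : 𝕜) • c) ∈ Z.graph :=
      Z.graph.add_mem hw (Z.graph.smul_mem ((r : ℝ) : 𝕜) hu)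
    have hd := (hZ.hasRightDerivAt hT hvg 0).sub
      (HasRightDerivAt.of_hasDerivAt (r := fun t => t) (hasDerivAt_id _) u)
    have hb : q (T 0 (a + ((r : ℝ) : 𝕜) • c) - ((1 : ℝ) : 𝕜) • u) < C' := by
      rw [hT.map_zero_apply, RCLike.ofReal_one, one_smul, map_sub_rev]
      exact (hC r (hr.2.le.trans hρ)).trans_lt hC'
    have hpos : 0 < ρ - r := tsub_pos_of_lt hr.2
    filter_upwards [hd.eventually_le hq hb, Ioc_mem_nhdsGT hpos] with h hh hh'
    have hsplit : ρ - r = (ρ - (r + h)) + h := by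
      rw [← tsub_tsub, tsub_add_cancel_of_le hh'.2]
    have heq : (T (ρ - (r + h)) w + (((r + h : ℝ≥0) : ℝ) : 𝕜) • T (ρ - (r + h)) u)
        - (T (ρ - r) w + ((r : ℝ) : 𝕜) • T (ρ - r) u)
        = T (ρ - (r + h)) (-((T (0 + h) v - (((0 + h : ℝ≥0) : ℝ) : 𝕜) • u)
          - (T 0 v - (((0 : ℝ≥0) : ℝ) : 𝕜) • u))) := by
      rw [hsplit, hT.map_add_apply, hT.map_add_apply]
      simp only [hv, zero_add, hT.map_zero_apply, NNReal.coe_zero, RCLike.ofReal_zero, zero_smul,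
        sub_zero, map_neg, map_sub, map_add, map_smul, NNReal.coe_add]
      module
    simp only [heq]
    refine (hpq _ (tsub_le_self.trans hρ) _).trans ?_
    rw [map_neg_eq_map]
    exact hh

/-- Over one short time step the perturbed orbit of `x` leaves the limit orbit at most linearly
fast, at a rate given by the oscillation of `l ↦ T 0 l (Z 0 x)`. The comparison curve is the
chord joining approximations of `x` and `T 0 δ x` from the domain of `Z s`. -/
theorem eventually_seminorm_sub_le_of_step {T : ℝ≥0 → ℝ≥0 → E →L[𝕜] E} {Z : ℝ≥0 → E →ₗ.[𝕜] E}
    (hT : ∀ s, IsLC0Semigroup (T s)) (hZ : ∀ s, IsGenerator (Z s) (T s))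
    (happ : ∀ x y, (x, y) ∈ (Z 0).graph → ∀ q : Seminorm 𝕜 E, Continuous q → ∀ ε > 0,
      ∀ᶠ s in 𝓝[>] 0, ∃ x' y', (x', y') ∈ (Z s).graph ∧ q (x' - x) < ε ∧ q (y' - y) < ε)
    {p q : Seminorm 𝕜 E} (hp : Continuous p) (hq : Continuous q) {δ : ℝ≥0} (hδ : 0 < δ)
    (hpq : ∀ s, ∀ l ≤ δ, ∀ v, p (T s l v) ≤ q v) {x z : E} (hx : (x, z) ∈ (Z 0).graph) {ε : ℝ}
    (hε : 0 < ε) (hz : ∀ l ≤ δ, q (T 0 l z - z) ≤ ε) :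
    ∀ᶠ s in 𝓝[>] 0, ∀ ρ ≤ δ, p (T s ρ x - T 0 ρ x) ≤ 11 * ε * δ := by
  have hδ0 : (0 : ℝ) < δ := NNReal.coe_pos.2 hδ
  have hpq0 : ∀ v, p v ≤ q v := fun v => by simpa [(hT 0).map_zero_apply] using hpq 0 0 zero_le v
  -- Points are approximated within `ε δ`, so that the slope of the chord is known up to `O(ε)`.
  have hη : 0 < min ε (ε * δ) := lt_min hε (by positivity)
  have htaylor : ∀ l ≤ δ, q (T 0 l x - x - ((l : ℝ) : 𝕜) • z) ≤ ε * l := fun l hl =>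
    (hZ 0).seminorm_taylor_le (hT 0) hq hx (fun l hl => hz l hl.le) hl
  filter_upwards [happ x z hx q hq _ hη,
    happ _ _ ((hZ 0).apply_mem_graph (hT 0) hx δ) q hq _ hη]
  rintro s ⟨w, a, hwa, hw, ha⟩ ⟨w', a', hwa', hw', ha'⟩ ρ hρ
  rw [lt_min_iff] at hw ha hw' ha'
  have hρ1 : (ρ : ℝ) ≤ δ := by exact_mod_cast hρ
  have hδ𝕜 : ((δ : ℝ) : 𝕜) ≠ 0 := by exact_mod_cast hδ0.ne'
  set u := ((δ : ℝ) : 𝕜)⁻¹ • (w' - w) with hu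
  set c := ((δ : ℝ) : 𝕜)⁻¹ • (a' - a) with hc
  have huc : (u, c) ∈ (Z s).graph := (Z s).graph.smul_mem ((δ : ℝ) : 𝕜)⁻¹
    ((Z s).graph.sub_mem hwa' hwa)
  have huz : q (u - z) ≤ 3 * ε := by
    have h1 : u - z = ((δ : ℝ) : 𝕜)⁻¹ • ((w' - T 0 δ x) - (w - x)
        + (T 0 δ x - x - ((δ : ℝ) : 𝕜) • z)) := by
      rw [hu, smul_add, smul_sub _ _ (((δ : ℝ) : 𝕜) • z), inv_smul_smul₀ hδ𝕜]
      module
    rw [h1, map_smul_eq_mul, norm_inv, norm_coe_nnreal, inv_mul_le_iff₀ hδ0]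
    have h2 := map_add_le_add q ((w' - T 0 δ x) - (w - x)) (T 0 δ x - x - ((δ : ℝ) : 𝕜) • z)
    have h3 := map_sub_le_add q (w' - T 0 δ x) (w - x)
    have h4 := htaylor δ le_rfl
    linarith [hw.2, hw'.2]
  have haz' : q (a' - z) ≤ 2 * ε := by
    have h1 := map_add_le_add q (a' - T 0 δ z) (T 0 δ z - z)
    rw [sub_add_sub_cancel] at h1
    linarith [hz δ le_rfl, ha'.1]
  have hdefect : ∀ r ≤ δ, q (u - (a + ((r : ℝ) : 𝕜) • c)) ≤ 5 * ε := by
    intro r hr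
    have hr1 : (r : ℝ) ≤ δ := by exact_mod_cast hr
    have hθ : ((r : ℝ) / δ : ℝ) ≤ 1 := (div_le_one hδ0).2 hr1
    have hθ0 : 0 ≤ ((r : ℝ) / δ : ℝ) := by positivity
    have h1 : u - (a + ((r : ℝ) : 𝕜) • c) = (u - z) - (((1 - (r : ℝ) / δ : ℝ) : 𝕜) • (a - z)
        + (((r : ℝ) / δ : ℝ) : 𝕜) • (a' - z)) := by
      rw [hc, smul_smul]
      push_cast
      rw [div_eq_mul_inv]
      module
    have h2 : q (((1 - (r : ℝ) / δ : ℝ) : 𝕜) • (a - z)) ≤ (1 - (r : ℝ) / δ) * ε := by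
      rw [map_smul_eq_mul, RCLike.norm_ofReal, abs_of_nonneg (sub_nonneg.2 hθ)]
      exact mul_le_mul_of_nonneg_left ha.1.le (sub_nonneg.2 hθ)
    have h3 : q ((((r : ℝ) / δ : ℝ) : 𝕜) • (a' - z)) ≤ ((r : ℝ) / δ) * (2 * ε) := by
      rw [map_smul_eq_mul, RCLike.norm_ofReal, abs_of_nonneg hθ0]
      exact mul_le_mul_of_nonneg_left haz' hθ0
    rw [h1]
    have h4 := map_sub_le_add q (u - z) (((1 - (r : ℝ) / δ : ℝ) : 𝕜) • (a - z)
        + (((r : ℝ) / δ : ℝ) : 𝕜) • (a' - z))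
    have h5 := map_add_le_add q (((1 - (r : ℝ) / δ : ℝ) : 𝕜) • (a - z))
      ((((r : ℝ) / δ : ℝ) : 𝕜) • (a' - z))
    nlinarith
  have hmain := (hZ s).seminorm_orbit_sub_affine_le (hT s) hp hq (hpq s) hwa huc hdefect hρ
  -- The five terms are at most `5 ε δ`, `ε δ`, `ε δ`, `3 ε δ` and `ε δ`.
  have h1 : T s ρ x - T 0 ρ x = (T s ρ w - (w + ((ρ : ℝ) : 𝕜) • u)) - T s ρ (w - x) + (w - x)
      + ((ρ : ℝ) : 𝕜) • (u - z) - (T 0 ρ x - x - ((ρ : ℝ) : 𝕜) • z) := by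
    rw [map_sub]; module
  have h2 : p (((ρ : ℝ) : 𝕜) • (u - z)) ≤ δ * (3 * ε) := by
    rw [map_smul_eq_mul, norm_coe_nnreal]
    exact mul_le_mul hρ1 ((hpq0 _).trans huz) (apply_nonneg p _) hδ0.le
  have h3 := (hpq0 _).trans (htaylor ρ hρ)
  have h4 := hpq s ρ hρ (w - x)
  have h5 := hpq0 (w - x)
  have h6 : ε * ρ ≤ ε * δ := mul_le_mul_of_nonneg_left hρ1 hε.le
  rw [h1]
  refine (map_sub_le_add p _ _).trans ?_
  refine (add_le_add_left ((map_add_le_add p _ _).trans (add_le_add_left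
    ((map_add_le_add p _ _).trans (add_le_add_left (map_sub_le_add p _ _) _)) _)) _).trans ?_
  linarith [hw.2]

end Convergence

/-! ### Cores and convergence -/

section Core

variable {𝕜 E : Type*} [RCLike 𝕜] [AddCommGroup E] [Module 𝕜 E] [UniformSpace E]

/-- The means `a⁻¹ ∫₀ᵃ T l g dl` converge to `g` as `a → 0+`. -/
theorem tendsto_mean {T : ℝ≥0 → E →L[𝕜] E} (hT : IsLC0Semigroup T) {g : E} {F : ℝ≥0 → E}
    (hF0 : F 0 = 0) (hF : HasRightDerivAt 𝕜 F (T 0 g) 0) :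
    Tendsto (fun a : ℝ≥0 => ((a : ℝ) : 𝕜)⁻¹ • F a) (𝓝[>] 0) (𝓝 g) := by
  rw [hT.map_zero_apply] at hF
  exact hF.congr fun a => by rw [zero_add, hF0, sub_zero]

variable [IsUniformAddGroup E] [PolynormableSpace 𝕜 E]

/-- If the approximable domain is a core, then every element of the graph of `Z 0` is close to
the graphs of all `Z s` with small `s`. -/
theorem IsCore.eventually_exists_mem_graph {Z : ℝ≥0 → E →ₗ.[𝕜] E}
    (hcore : IsCore (Z 0) (approxDomain Z)) {x y : E}
    (hxy : (x, y) ∈ (Z 0).graph) {q : Seminorm 𝕜 E} (hq : Continuous q) {ε : ℝ} (hε : 0 < ε) :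
    ∀ᶠ s in 𝓝[>] 0, ∃ x' y', (x', y') ∈ (Z s).graph ∧ q (x' - x) < ε ∧ q (y' - y) < ε := by
  have hcl : (x, y) ∈ closure {z : E × E | z ∈ (Z 0).graph ∧ z.1 ∈ approxDomain Z} := by
    rw [hcore.2]; exact hxy
  have hc : Tendsto (fun z : E × E => (q (z.1 - x), q (z.2 - y))) (𝓝 (x, y)) (𝓝 (0, 0)) :=
    Continuous.tendsto' (by fun_prop) _ _ (by simp)
  obtain ⟨⟨x₁, y₁⟩, ⟨h1, h2⟩, hgr, hdom, u, hux, huy⟩ := mem_closure_iff_nhds.1 hcl _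
    (hc (prod_mem_nhds (Iio_mem_nhds (half_pos hε)) (Iio_mem_nhds (half_pos hε))))
  have hy₁ : Z 0 ⟨x₁, hdom⟩ = y₁ := ((LinearPMap.image_iff _).2 hgr).symm
  rw [hy₁] at huy
  simp only [mem_Iio] at h1 h2
  filter_upwards [(tendsto_nhds_iff_seminorm (𝕜 := 𝕜)).1 hux q hq _ (half_pos hε),
    (tendsto_nhds_iff_seminorm (𝕜 := 𝕜)).1 huy q hq _ (half_pos hε)] with s hs1 hs2
  refine ⟨u s, Z s (u s), LinearPMap.mem_graph _ _, ?_, ?_⟩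
  · have := map_add_le_add q ((u s : E) - x₁) (x₁ - x)
    rw [sub_add_sub_cancel] at this
    linarith
  · have := map_add_le_add q (Z s (u s) - y₁) (y₁ - y)
    rw [sub_add_sub_cancel] at this
    linarith

variable [ContinuousSMul 𝕜 E] [T2Space E]

theorem IsGenerator.dense_domain (hE : IsSequentiallyComplete E) {T : ℝ≥0 → E →L[𝕜] E}
    {Z : E →ₗ.[𝕜] E} (hT : IsLC0Semigroup T) (hZ : IsGenerator Z T) :
    Dense (Z.domain : Set E) := by
  intro g
  obtain ⟨F, hF0, hFc, hF⟩ := exists_antiderivative (𝕜 := 𝕜) hE (hT.continuous g)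
  refine mem_closure_of_tendsto (tendsto_mean hT hF0 (hF 0 ⟨le_rfl, one_pos⟩)) ?_
  filter_upwards [Ioo_mem_nhdsGT one_pos] with a ha
  exact Z.domain.smul_mem _ (LinearPMap.mem_domain_of_mem_graph
    (hZ.antiderivative_mem_graph hT hF0 hFc hF ha.2))

variable {T : ℝ≥0 → ℝ≥0 → E →L[𝕜] E} {Z : ℝ≥0 → E →ₗ.[𝕜] E}

/-- If the semigroups converge, then the approximable domain is a core: it contains all the
means `a⁻¹ ∫₀ᵃ T 0 l g dl`, which are approximated by the same means for `T s`. -/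
theorem isCore_approxDomain (hE : IsSequentiallyComplete E) (hT : ∀ s, IsLC0Semigroup (T s))
    (hZ : ∀ s, IsGenerator (Z s) (T s))
    (hconv : ∀ f : E, TendstoUniformlyOn (fun s l => T s l f) (fun l => T 0 l f)
      (𝓝[>] 0) (Icc 0 1)) :
    IsCore (Z 0) (approxDomain Z) := by
  refine ⟨fun f hf => hf.1, Subset.antisymm
    (closure_minimal (fun q hq => hq.1) ((hZ 0).isClosed_graph (hT 0))) ?_⟩
  rintro ⟨g, y⟩ hgy
  choose F hF0 hFc hF using fun s => exists_antiderivative (𝕜 := 𝕜) hE ((hT s).continuous g)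
  have hy : Tendsto (fun a : ℝ≥0 => ((a : ℝ) : 𝕜)⁻¹ • (T 0 a g - g)) (𝓝[>] 0) (𝓝 y) := by
    refine Tendsto.congr (fun a => ?_) ((hZ 0 g y).1 hgy)
    rw [(hT 0).map_zero_apply]
  refine mem_closure_of_tendsto
    ((tendsto_mean (hT 0) (hF0 0) (hF 0 0 ⟨le_rfl, one_pos⟩)).prodMk_nhds hy) ?_
  filter_upwards [Ioo_mem_nhdsGT one_pos] with a ha
  have hmem : ∀ s, (((a : ℝ) : 𝕜)⁻¹ • F s a, ((a : ℝ) : 𝕜)⁻¹ • (T s a g - g)) ∈ (Z s).graph :=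
    fun s => (Z s).graph.smul_mem ((a : ℝ) : 𝕜)⁻¹
      ((hZ s).antiderivative_mem_graph (hT s) (hF0 s) (hFc s) (hF s) ha.2)
  have hZF : ∀ s, Z s ⟨_, LinearPMap.mem_domain_of_mem_graph (hmem s)⟩
      = ((a : ℝ) : 𝕜)⁻¹ • (T s a g - g) :=
    fun s => ((LinearPMap.image_iff _).2 (hmem s)).symm
  refine ⟨hmem 0, LinearPMap.mem_domain_of_mem_graph (hmem 0),
    fun s => ⟨_, LinearPMap.mem_domain_of_mem_graph (hmem s)⟩, ?_, ?_⟩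
  · refine Tendsto.const_smul ?_ _
    refine (tendsto_nhds_iff_seminorm (𝕜 := 𝕜)).2 fun p hp ε hε => ?_
    filter_upwards [(tendstoUniformlyOn_iff_seminorm (𝕜 := 𝕜)).1 (hconv g) p hp (ε / 2)
      (half_pos hε)] with s hs
    have h1 := seminorm_sub_le_of_hasRightDerivAt (𝕜 := 𝕜) (a := 0) (b := 1) hp
      (φ := fun x => F s x - F 0 x) (φ' := fun x => T s x g - T 0 x g)
      ((hFc s).sub (hFc 0)) (fun x hx => (hF s x hx).sub (hF 0 x hx))
      (fun x hx => (hs x ⟨hx.1, hx.2.le⟩).le) (x := a) ⟨zero_le, ha.2.le⟩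
    simp only [hF0, sub_zero, NNReal.coe_zero] at h1
    have ha1 : (a : ℝ) < 1 := by exact_mod_cast ha.2
    nlinarith
  · simp only [hZF]
    exact (((hconv g).tendsto_at ⟨zero_le, ha.2.le⟩).sub_const g).const_smul _

/-- If the approximable domain is a core, then the semigroups converge. -/
theorem IsCore.tendstoUniformlyOn (hE : IsSequentiallyComplete E)
    (hT : ∀ s, IsLC0Semigroup (T s)) (hZ : ∀ s, IsGenerator (Z s) (T s))
    (hA : ∀ l₀ : ℝ≥0, IsEquicontinuous {G : E →L[𝕜] E | ∃ l s : ℝ≥0, l ≤ l₀ ∧ G = T s l})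
    (hcore : IsCore (Z 0) (approxDomain Z)) (t₀ : ℝ≥0) (f : E) :
    TendstoUniformlyOn (fun s l => T s l f) (fun l => T 0 l f) (𝓝[>] 0) (Icc 0 t₀) := by
  refine (tendstoUniformlyOn_iff_seminorm (𝕜 := 𝕜)).2 fun p hp ε hε => ?_
  -- `p₁` controls the propagation of errors up to time `t₀ + 1`, `q` the error of a single step.
  obtain ⟨p₁, hp₁, hpp₁⟩ := (hA (t₀ + 1)).exists_seminorm hp
  obtain ⟨q, hq, hp₁q⟩ := (hA 1).exists_seminorm hp₁
  replace hpp₁ : ∀ s, ∀ l ≤ t₀ + 1, ∀ v, p (T s l v) ≤ p₁ v :=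
    fun s l hl v => hpp₁ _ ⟨l, s, hl, rfl⟩ v
  replace hp₁q : ∀ s, ∀ l ≤ 1, ∀ v, p₁ (T s l v) ≤ q v :=
    fun s l hl v => hp₁q _ ⟨l, s, hl, rfl⟩ v
  obtain ⟨g, hg, hgf⟩ : ∃ g, p₁ (g - f) < ε / 4 ∧ g ∈ (Z 0).domain := by
    have hc : Tendsto (fun g => p₁ (g - f)) (𝓝 f) (𝓝 0) :=
      Continuous.tendsto' (by fun_prop) _ _ (by simp)
    have h4 : (0 : ℝ) < ε / 4 := by positivity
    exact mem_closure_iff_nhds.1 ((hZ 0).dense_domain hE (hT 0) f) _ (hc (Iio_mem_nhds h4))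
  obtain ⟨y, hgy⟩ : ∃ y, (g, y) ∈ (Z 0).graph := ⟨_, LinearPMap.mem_graph _ ⟨g, hgf⟩⟩
  -- The step errors `11 η δ` add up to at most `11 η (t₀ + 1) = ε / 4`.
  set η : ℝ := ε / (44 * (t₀ + 1)) with hη
  have hη0 : 0 < η := by positivity
  obtain ⟨δ, hδ0, hδ1, hδ⟩ : ∃ δ : ℝ≥0, 0 < δ ∧ δ ≤ 1 ∧ ∀ h ≤ δ, ∀ l ∈ Icc 0 t₀,
      q (T 0 h (T 0 l y) - T 0 l y) < η := by
    have h1 : ∀ᶠ h in 𝓝 (0 : ℝ≥0), ∀ l ∈ Icc 0 t₀, q (T 0 (h + l) y - T 0 l y) < η := by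
      refine isCompact_Icc.eventually_forall_of_forall_eventually fun l _ => ?_
      have hc := (hT 0).continuous y
      have h2 : Continuous fun z : ℝ≥0 × ℝ≥0 => q (T 0 (z.1 + z.2) y - T 0 z.2 y) :=
        hq.comp ((hc.comp (continuous_fst.add continuous_snd)).sub (hc.comp continuous_snd))
      exact (h2.tendsto' (0, l) 0 (by simp)).eventually_lt_const hη0
    obtain ⟨δ', hδ', h2⟩ := (NNReal.nhds_zero_basis.eventually_iff).1 h1
    refine ⟨min (δ' / 2) 1, lt_min (by positivity) one_pos, min_le_right _ _,
      fun h hh l hl => ?_⟩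
    rw [← (hT 0).map_add_apply]
    exact h2 ((hh.trans (min_le_left _ _)).trans_lt (NNReal.half_lt_self hδ'.ne')) l hl
  set N := ⌊t₀ / δ⌋₊ with hN
  have hNδ : ∀ n ≤ N, n * δ ≤ t₀ := fun n hn => by
    have h1 : (n : ℝ≥0) ≤ t₀ / δ := (Nat.cast_le.2 hn).trans (Nat.floor_le zero_le)
    exact (le_div_iff₀ hδ0).1 h1
  have hsteps : ∀ᶠ s in 𝓝[>] 0, ∀ n ∈ Iic N, ∀ ρ ≤ δ,
      p₁ (T s ρ (T 0 (n * δ) g) - T 0 ρ (T 0 (n * δ) g)) ≤ 11 * η * δ :=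
    (eventually_all_finite (finite_Iic N)).2 fun n hn =>
      eventually_seminorm_sub_le_of_step hT hZ
        (fun x y hxy q hq ε hε => hcore.eventually_exists_mem_graph hxy hq hε) hp₁ hq hδ0
        (fun s l hl v => hp₁q s l (hl.trans hδ1) v)
        ((hZ 0).apply_mem_graph (hT 0) hgy (n * δ)) hη0
        (fun l hl => (hδ l hl (n * δ) ⟨zero_le, hNδ n hn⟩).le)
  filter_upwards [hsteps] with s hs l hl
  obtain ⟨n, hnN, ρ, hρ, rfl⟩ : ∃ n ≤ N, ∃ ρ ≤ δ, l = ρ + n * δ := by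
    have h1 := (div_lt_iff₀ hδ0).1 (Nat.lt_floor_add_one (l / δ))
    rw [add_one_mul] at h1
    have h2 : ⌊l / δ⌋₊ * δ ≤ l := (le_div_iff₀ hδ0).1 (Nat.floor_le zero_le)
    exact ⟨⌊l / δ⌋₊, Nat.floor_mono (div_le_div_of_nonneg_right hl.2 hδ0.le),
      l - ⌊l / δ⌋₊ * δ, tsub_le_iff_left.2 h1.le, (tsub_add_cancel_of_le h2).symm⟩
  have hl1 : ρ + n * δ ≤ t₀ + 1 := hl.2.trans le_self_add
  have h1 := seminorm_sub_le_of_steps (hT s) (hT 0) (t := t₀ + 1) (N := N) (hpp₁ s)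
    (fun n hn => hs n hn.le δ le_rfl) n hnN ρ (by rwa [add_comm])
  have hpp : ∀ v, p v ≤ p₁ v := fun v => by
    simpa [(hT 0).map_zero_apply] using hpp₁ 0 0 zero_le v
  have h2 := (hpp _).trans (hs n hnN ρ hρ)
  have h3 := hpp₁ s _ hl1 (g - f)
  have h4 := hpp₁ 0 _ hl1 (g - f)
  have h5 : (n : ℝ) * (11 * η * δ) + 11 * η * δ ≤ ε / 4 := by
    have h6 : ((n : ℝ) * δ + δ) ≤ t₀ + 1 := by
      have h7 : (n : ℝ) * δ ≤ t₀ := by exact_mod_cast hNδ n hnN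
      have h8 : (δ : ℝ) ≤ 1 := by exact_mod_cast hδ1
      linarith
    calc (n : ℝ) * (11 * η * δ) + 11 * η * δ = 11 * η * ((n : ℝ) * δ + δ) := by ring
      _ ≤ 11 * η * (t₀ + 1) := mul_le_mul_of_nonneg_left h6 (by positivity)
      _ = ε / 4 := by rw [hη]; field_simp; norm_num
  have h6 : T s (ρ + n * δ) f - T 0 (ρ + n * δ) f
      = (T s ρ (T s (n * δ) g) - T s ρ (T 0 (n * δ) g))
        + (T s ρ (T 0 (n * δ) g) - T 0 ρ (T 0 (n * δ) g))
        - T s (ρ + n * δ) (g - f) + T 0 (ρ + n * δ) (g - f) := by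
    rw [map_sub, map_sub, (hT s).map_add_apply _ _ g, (hT 0).map_add_apply _ _ g]
    abel
  rw [h6]
  refine (map_add_le_add p _ _).trans_lt ?_
  refine (add_le_add_left ((map_sub_le_add p _ _).trans (add_le_add_left
    (map_add_le_add p _ _) _)) _).trans_lt ?_
  linarith

end Core

end LCSemigroup

theorem theorem6p2 {𝕜 E : Type*} [RCLike 𝕜] [AddCommGroup E] [Module 𝕜 E]
    [UniformSpace E] [IsUniformAddGroup E] [ContinuousSMul 𝕜 E] [PolynormableSpace 𝕜 E]
    [T2Space E] (hE : LCSemigroup.IsSequentiallyComplete E)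
    (Z : ℝ≥0 → E →ₗ.[𝕜] E) (T : ℝ≥0 → ℝ≥0 → E →L[𝕜] E)
    (hT : ∀ s : ℝ≥0, LCSemigroup.IsLC0Semigroup (T s))
    (hZ : ∀ s : ℝ≥0, LCSemigroup.IsGenerator (Z s) (T s))
    (hA : ∀ l₀ : ℝ≥0, LCSemigroup.IsEquicontinuous {G : E →L[𝕜] E | ∃ l s : ℝ≥0, l ≤ l₀ ∧ G = T s l}) :
    (∀ t₀ : ℝ≥0, 0 < t₀ → ∀ f : E,
        TendstoUniformlyOn (fun s l => T s l f) (fun l => T 0 l f) (𝓝[>] 0) (Set.Icc 0 t₀)) ↔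
      LCSemigroup.IsCore (Z 0) (LCSemigroup.approxDomain Z) := by
  exact ⟨fun h => LCSemigroup.isCore_approxDomain hE hT hZ (h 1 one_pos),
    fun h t₀ _ f => h.tendstoUniformlyOn hE hT hZ hA t₀ f⟩
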